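/- All cardinals below are cardinalities of sets. For a topological space $M$, a family $\mathcal C$ of subsets of $M$ is \emph{generating} if a set $A\subseteq M$ is closed in $M$ if and only if $A\cap C$ is closed in $C$ for every $C\in\mathcal C$. Let $k(M)$ be the minimum size of a generating family of compact subsets of $M$, and let $kc(M)$ be the minimum size of a family of compact subsets of $M$ whose union is $M$. For a cardinal $\kappa$, let $\operatorname{cov}(\kappa)$ be the minimum size of a family of countable subsets of $\kappa$ such that every countable subset of $\kappa$ is contained in a member of the family. Let $\mathfrak b$ be the minimum size of a subset of $\omega^\omega$ that is unbounded in the order $<^*$, where $f<^*g$ if $f(n)<g(n)$ for all but finitely many $n$. The space $M$ is \emph{totally imperfect} if every compact subset of $M$ is countable, and \emph{locally small} if every point of $M$ has a neighborhood of size strictly less than $|M|$. \textbf{Theorem.} Let $M$ be a separable metrizable space that is not $\sigma$-compact. (i) If $M$ is totally imperfect but not locally small, then $k(M)=\operatorname{cov}(kc(M))\cdot\mathfrak b$. (ii) If $M$ is locally small, then $k(M)=\lim_{\mu<kc(M)}\operatorname{cov}(\mu)\cdot\mathfrak b$, where $\mu$ ranges over all cardinals less than $kc(M)$ and, $\operatorname{cov}(\mu)\cdot\mathfrak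 b$ being nondecreasing in $\mu$, the limit is the supremum $\sup\{\operatorname{cov}(\mu)\cdot\mathfrak b : \mu<kc(M)\}$. -/

import Mathlib

open Cardinal Topology Filter

universe u

noncomputable section

/-- A family `C` of subsets of `M` generates the topology of `M` if a set `A` is closed in `M`
exactly when `A ∩ K` is closed in the subspace `K` for every `K ∈ C`. -/
def IsGenerating (M : Type u) [TopologicalSpace M] (C : Set (Set M)) : Prop :=
  ∀ A : Set M, IsClosed A ↔ ∀ K ∈ C, IsClosed ((fun x : K => (x : M)) ⁻¹' A)

/-- The `k`-ness number: the minimum size of a generating family of compact subsets. -/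
def kNumber (M : Type u) [TopologicalSpace M] : Cardinal.{u} :=
  sInf {c | ∃ C : Set (Set M), (∀ K ∈ C, IsCompact K) ∧ IsGenerating M C ∧ #C = c}

/-- The compact covering number: the minimum number of compact subsets that cover `M`. -/
def kcNumber (M : Type u) [TopologicalSpace M] : Cardinal.{u} :=
  sInf {c | ∃ C : Set (Set M), (∀ K ∈ C, IsCompact K) ∧ ⋃₀ C = Set.univ ∧ #C = c}

/-- The covering number of a cardinal `κ`: the minimum size of a family of countable subsets of
(a set of size) `κ` such that every countable subset is contained in a member of the family. -/
def covNumber (κ : Cardinal.{u}) : Cardinal.{u} :=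
  sInf {c | ∃ F : Set (Set κ.out), (∀ A ∈ F, A.Countable) ∧
    (∀ B : Set κ.out, B.Countable → ∃ A ∈ F, B ⊆ A) ∧ #F = c}

/-- The mod finite order on functions `ℕ → ℕ`. -/
def ModFiniteLT (f g : ℕ → ℕ) : Prop :=
  {n | ¬ f n < g n}.Finite

/-- The bounding number: the minimum size of a subset of `ℕ → ℕ` that is unbounded in the
mod finite order. -/
def boundingNumber : Cardinal.{0} :=
  sInf {c | ∃ S : Set (ℕ → ℕ), (¬ ∃ g : ℕ → ℕ, ∀ f ∈ S, ModFiniteLT f g) ∧ #S = c}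

/-- Every compact subset is countable. -/
def IsTotallyImperfect (M : Type u) [TopologicalSpace M] : Prop :=
  ∀ K : Set M, IsCompact K → K.Countable

/-- Every point has a neighborhood of size strictly less than that of the space. -/
def IsLocallySmall (M : Type u) [TopologicalSpace M] : Prop :=
  ∀ x : M, ∃ U ∈ 𝓝 x, #U < #M

/-- The limit of `f μ` as the cardinal `μ` increases to `κ`, for a nondecreasing `f`: the supremum
of the values of `f` below `κ`. -/
def limBelow (κ : Cardinal.{u}) (f : Cardinal.{u} → Cardinal.{u}) : Cardinal.{u} :=
  ⨆ μ : Set.Iio κ, f μ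

/-- The supremum defining `limBelow` is a genuine least upper bound when `κ ≠ 0`. -/
theorem isLUB_limBelow (κ : Cardinal.{u}) (hκ : κ ≠ 0) (f : Cardinal.{u} → Cardinal.{u}) :
    IsLUB (f '' Set.Iio κ) (limBelow κ f) := by
  have hne : Nonempty (Set.Iio κ) := ⟨⟨0, pos_iff_ne_zero.2 hκ⟩⟩
  have h := isLUB_ciSup (bddAbove_of_small (s := Set.range (fun μ : Set.Iio κ => f μ)))
  rwa [show Set.range (fun μ : Set.Iio κ => f μ) = f '' Set.Iio κ by ext; simp] at h

end

universe v

/-! ### The bounding number -/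

/-! In a metric space, a family of compact sets is generating as soon as it catches, for every
convergent sequence, the limit and infinitely many terms. Upper bound (`exists_compact_family`): a
countable set from a cofinal family contains the sequence, and a function from an unbounded family
bounds the indices of infinitely many terms in an enumeration of that set; this gives cov·𝔟 compact
sets.

Lower bounds are local. A point without compact neighbourhood forces 𝔟
(`boundingNumber_le_kNumber`); if compact sets are countable, a point whose neighbourhoods all have
size at least μ forces cov(μ) (`covNumber_le_kNumber`).

Total imperfection gives kc(M) = |M|. In (i) some point serves μ = |M|. In (ii) countably many small
neighbourhoods cover M, and each infinite μ < |M| is served by some point; total imperfection is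
automatic, since |M| < 𝔠. -/

theorem exists_unbounded_mk_eq_boundingNumber :
    ∃ S : Set (ℕ → ℕ), (¬ ∃ g : ℕ → ℕ, ∀ f ∈ S, ModFiniteLT f g) ∧ #S = boundingNumber := by
  refine csInf_mem (s := {c | ∃ S : Set (ℕ → ℕ),
    (¬ ∃ g : ℕ → ℕ, ∀ f ∈ S, ModFiniteLT f g) ∧ #S = c}) ⟨_, Set.univ, ?_, rfl⟩
  rintro ⟨g, hg⟩
  have h := hg g trivial
  simp only [ModFiniteLT, lt_irrefl, not_false_eq_true, Set.ofPred_true] at h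
  exact Set.infinite_univ h

theorem exists_modFiniteLT_of_mk_lt {ι : Type v} (f : ι → ℕ → ℕ)
    (h : #ι < Cardinal.lift.{v} boundingNumber) : ∃ g, ∀ i, ModFiniteLT (f i) g := by
  by_contra hn
  have h1 : boundingNumber ≤ #(Set.range f) := by
    refine csInf_le' ⟨Set.range f, ?_, rfl⟩
    rintro ⟨g, hg⟩
    exact hn ⟨g, fun i => hg _ ⟨i, rfl⟩⟩
  have h2 : Cardinal.lift.{v} #(Set.range f) ≤ #ι := by
    simpa using Cardinal.mk_range_le_lift (f := f)
  exact absurd h (not_lt.2 ((Cardinal.lift_le.2 h1).trans h2))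

theorem aleph0_le_boundingNumber : ℵ₀ ≤ boundingNumber := by
  by_contra hn
  obtain ⟨S, hS, hc⟩ := exists_unbounded_mk_eq_boundingNumber
  have hfin : S.Finite := Cardinal.lt_aleph0_iff_set_finite.1 (hc ▸ not_le.1 hn)
  refine hS ⟨fun n => ∑ f ∈ hfin.toFinset, f n + 1, fun f hf => ?_⟩
  have h : ∀ n, f n < ∑ f ∈ hfin.toFinset, f n + 1 := fun n =>
    Nat.lt_succ_of_le (Finset.single_le_sum (f := fun f : ℕ → ℕ => f n)
      (fun _ _ => Nat.zero_le _) (hfin.mem_toFinset.2 hf))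
  simp [ModFiniteLT, h]

/-! ### The covering number of a cardinal -/

theorem covNumber_le_of_family {α ι : Type v} (F : ι → Set α) (hF : ∀ i, (F i).Countable)
    (hcof : ∀ B : Set α, B.Countable → ∃ i, B ⊆ F i) : covNumber #α ≤ #ι := by
  obtain ⟨e⟩ := Cardinal.eq.1 (Cardinal.mk_out #α)
  refine le_trans (csInf_le' ⟨Set.range fun i => e ⁻¹' F i, ?_, fun B hB => ?_, rfl⟩)
    Cardinal.mk_range_le
  · rintro _ ⟨i, rfl⟩
    exact (hF i).preimage e.injective
  · obtain ⟨i, hi⟩ := hcof (e '' B) (hB.image e)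
    exact ⟨_, ⟨i, rfl⟩, Set.image_subset_iff.1 hi⟩

theorem exists_family_mk_le_covNumber (α : Type v) :
    ∃ (ι : Type v) (F : ι → Set α), (∀ i, (F i).Countable) ∧
      (∀ B : Set α, B.Countable → ∃ i, B ⊆ F i) ∧ #ι = covNumber #α := by
  obtain ⟨F, hF, hcof, hc⟩ := csInf_mem (s := {c | ∃ F : Set (Set (#α).out),
    (∀ A ∈ F, A.Countable) ∧ (∀ B : Set (#α).out, B.Countable → ∃ A ∈ F, B ⊆ A) ∧ #F = c})
    ⟨_, {A | A.Countable}, fun _ h => h, fun B hB => ⟨B, hB, subset_rfl⟩, rfl⟩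
  obtain ⟨e⟩ := Cardinal.eq.1 (Cardinal.mk_out #α)
  refine ⟨F, fun A => e '' A, fun A => (hF A A.2).image e, fun B hB => ?_, hc⟩
  obtain ⟨A, hA, hBA⟩ := hcof (e ⁻¹' B) (hB.preimage e.injective)
  exact ⟨⟨A, hA⟩, fun b hb => ⟨e.symm b, hBA (by simpa using hb), by simp⟩⟩

theorem covNumber_le_one {μ : Cardinal.{v}} (h : μ ≤ ℵ₀) : covNumber μ ≤ 1 := by
  have hc : Countable μ.out := Cardinal.mk_le_aleph0_iff.1 (by simpa using h)
  have := covNumber_le_of_family (α := μ.out) (ι := PUnit.{v + 1}) (fun _ => Set.univ)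
    (fun _ => Set.countable_univ) (fun B _ => ⟨⟨⟩, Set.subset_univ B⟩)
  simpa using this

/-! ### Generating families of compact sets -/

theorem isGenerating_of_mem_closure {M : Type v} [TopologicalSpace M] {C : Set (Set M)}
    (h : ∀ (B : Set M) (x : M), x ∈ closure B → ∃ K ∈ C, x ∈ K ∧ x ∈ closure (B ∩ K)) :
    IsGenerating M C := by
  refine fun B => ⟨fun hB K _ => hB.preimage continuous_subtype_val, fun hB => ?_⟩
  refine isClosed_of_closure_subset fun x hx => ?_
  obtain ⟨K, hK, hxK, hcl⟩ := h B x hx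
  obtain ⟨Z, hZ, hZB⟩ := isClosed_induced_iff.1 (hB K hK)
  have hiff : ∀ y ∈ K, y ∈ Z ↔ y ∈ B := fun y hy =>
    Set.ext_iff.1 hZB (⟨y, hy⟩ : K)
  exact (hiff x hxK).1
    (closure_minimal (fun y hy => (hiff y hy.2).2 hy.1) hZ hcl)

/-- Otherwise the range of the sequence has finite, hence closed, trace on every member, so it is
closed and contains its limit. -/
theorem IsGenerating.exists_infinite {M : Type v} [TopologicalSpace M] [T1Space M]
    {C : Set (Set M)} (hC : IsGenerating M C) {y : ℕ → M} {x : M}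
    (hy : Tendsto y atTop (𝓝 x)) (hne : ∀ n, y n ≠ x) :
    ∃ K ∈ C, {n | y n ∈ K}.Infinite := by
  by_contra! hfin
  have hcl : IsClosed (Set.range y) := by
    refine (hC _).2 fun K hK => Set.Finite.isClosed ?_
    refine Set.Finite.preimage Subtype.val_injective.injOn ?_ |>.subset
      (s := Subtype.val ⁻¹' (y '' {n | y n ∈ K})) ?_
    · exact (Set.not_infinite.1 (by simpa using hfin K hK)).image y
    · rintro ⟨_, hk⟩ ⟨n, rfl⟩
      exact ⟨n, hk, rfl⟩
  obtain ⟨n, hn⟩ := hcl.mem_of_tendsto hy (Eventually.of_forall fun n => ⟨n, rfl⟩)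
  exact hne n hn

theorem isCompact_insert_of_finite_diff {M : Type v} [TopologicalSpace M] {x : M} {T : Set M}
    (h : ∀ U ∈ 𝓝 x, (T \ U).Finite) : IsCompact (insert x T) := by
  have ht : Tendsto (Subtype.val : T → M) cofinite (𝓝 x) := fun U hU => by
    refine mem_cofinite.2 (((h U hU).preimage Subtype.val_injective.injOn).subset ?_)
    exact fun t ht => ⟨t.2, ht⟩
  simpa using ht.isCompact_insert_range_of_cofinite

theorem exists_compact_family {M : Type v} [MetricSpace M] (U : Set M) :
    ∃ C : Set (Set M), (∀ K ∈ C, IsCompact K) ∧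
      #C ≤ covNumber #U * Cardinal.lift.{v} boundingNumber ∧
      ∀ (B : Set M) (x : M), U ∈ 𝓝 x → x ∈ closure B →
        ∃ K ∈ C, x ∈ K ∧ x ∈ closure (B ∩ K) := by
  rcases U.eq_empty_or_nonempty with rfl | hU
  · exact ⟨∅, by simp, by simp, fun B x h => absurd (mem_of_mem_nhds h) (by simp)⟩
  obtain ⟨ι, F, hF, hcof, hι⟩ := exists_family_mk_le_covNumber U
  obtain ⟨S, hS, hSc⟩ := exists_unbounded_mk_eq_boundingNumber
  have : Nonempty U := hU.to_subtype
  have henum : ∀ i, ∃ e : ℕ → U, F i ⊆ Set.range e := fun i =>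
    Set.countable_iff_exists_subset_range.1 (hF i)
  choose e he using henum
  -- Stage `n` admits only the finitely many indices up to `f n`, within `1 / (n + 1)` of the centre
  -- `e i k`; hence the points accumulate only at the centre.
  let T : ι → ℕ → (ℕ → ℕ) → Set M := fun i k f =>
    {y | ∃ n j, j ≤ f n ∧ (e i j : M) = y ∧ dist y (e i k) < 1 / ((n : ℝ) + 1)}
  let G : ι × ULift.{v} (ℕ × S) → Set M := fun p =>
    insert (e p.1 p.2.down.1 : M) (T p.1 p.2.down.1 p.2.down.2)
  refine ⟨Set.range G, ?_, ?_, fun B x hx hB => ?_⟩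
  · rintro _ ⟨⟨i, ⟨k, f⟩⟩, rfl⟩
    refine isCompact_insert_of_finite_diff fun V hV => ?_
    obtain ⟨ε, hε, hεV⟩ := Metric.mem_nhds_iff.1 hV
    obtain ⟨N, hN⟩ := exists_nat_one_div_lt hε
    refine (((Set.finite_lt_nat N).biUnion fun n _ =>
      (Set.finite_le_nat (f.1 n)).image fun j => (e i j : M))).subset ?_
    rintro y ⟨⟨n, j, hj, hjy, hd⟩, hyV⟩
    refine Set.mem_biUnion (x := n) ?_ ⟨j, hj, hjy⟩
    by_contra hn
    refine hyV (hεV (hd.trans (lt_of_le_of_lt ?_ hN)))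
    exact Nat.one_div_le_one_div (not_lt.1 hn)
  · refine Cardinal.mk_range_le.trans ?_
    rw [Cardinal.mk_prod, Cardinal.lift_id, Cardinal.lift_id, hι, Cardinal.mk_uLift,
      Cardinal.mk_prod, Cardinal.lift_id, Cardinal.lift_id, hSc, Cardinal.mk_nat,
      Cardinal.aleph0_mul_eq aleph0_le_boundingNumber]
  · have hb : ∀ n : ℕ, ∃ y ∈ B, y ∈ U ∧ dist y x < 1 / ((n : ℝ) + 1) := fun n => by
      obtain ⟨y, ⟨hyU, hyd⟩, hyB⟩ := mem_closure_iff_nhds.1 hB _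
        (inter_mem hx (Metric.ball_mem_nhds x (Nat.one_div_pos_of_nat (n := n))))
      exact ⟨y, hyB, hyU, hyd⟩
    choose y hyB hyU hyd using hb
    obtain ⟨i, hi⟩ := hcof (insert ⟨x, mem_of_mem_nhds hx⟩ (Set.range fun n => ⟨y n, hyU n⟩))
      ((Set.countable_range _).insert _)
    obtain ⟨k, hk⟩ := he i (hi (Set.mem_insert _ _))
    have hg : ∀ n, ∃ j, e i j = ⟨y n, hyU n⟩ := fun n =>
      he i (hi (Set.mem_insert_of_mem _ ⟨n, rfl⟩))
    choose g hg using hg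
    -- `g n` is the index of `y n` in the enumeration, so `g n ≤ f n` puts `y n` in the compact set.
    have hfS : ∃ f ∈ S, {n | ¬ f n < g n}.Infinite := by
      by_contra! hcon
      exact hS ⟨g, fun f hf => by simpa [ModFiniteLT] using hcon f hf⟩
    obtain ⟨f, hf, hinf⟩ := hfS
    refine ⟨G (i, ⟨k, f, hf⟩), ⟨_, rfl⟩, Or.inl (by simp [hk]), Metric.mem_closure_iff.2 ?_⟩
    intro ε hε
    obtain ⟨N, hN⟩ := exists_nat_one_div_lt hε
    obtain ⟨n, hn, hNn⟩ := hinf.exists_gt N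
    refine ⟨y n, ⟨hyB n, Or.inr ⟨n, g n, not_lt.1 hn, by simp [hg], by simpa [hk] using hyd n⟩⟩,
      ?_⟩
    rw [dist_comm]
    exact (hyd n).trans ((Nat.one_div_le_one_div hNn.le).trans_lt hN)

theorem exists_isGenerating_mk_eq_kNumber (M : Type v) [MetricSpace M] :
    ∃ C : Set (Set M), (∀ K ∈ C, IsCompact K) ∧ IsGenerating M C ∧ #C = kNumber M := by
  obtain ⟨C, hC, -, hgen⟩ := exists_compact_family (Set.univ : Set M)
  exact csInf_mem (s := {c | ∃ C : Set (Set M), (∀ K ∈ C, IsCompact K) ∧ IsGenerating M C ∧ #C = c})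
    ⟨_, C, hC, isGenerating_of_mem_closure fun B x => hgen B x univ_mem, rfl⟩

theorem kNumber_le_covNumber_mul (M : Type v) [MetricSpace M] :
    kNumber M ≤ covNumber #M * Cardinal.lift.{v} boundingNumber := by
  obtain ⟨C, hC, hcard, hgen⟩ := exists_compact_family (Set.univ : Set M)
  rw [Cardinal.mk_univ] at hcard
  exact le_trans
    (csInf_le' ⟨C, hC, isGenerating_of_mem_closure fun B x => hgen B x univ_mem, rfl⟩) hcard

/-! ### Lower bounds -/

theorem exists_seq_finite_inter_compact {M : Type v} [MetricSpace M] {s : Set M}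
    (hs : IsClosed s) (hnc : ¬ IsCompact s) :
    ∃ u : ℕ → M, (∀ n, u n ∈ s) ∧ ∀ K, IsCompact K → {n | u n ∈ K}.Finite := by
  have h : ¬ IsSeqCompact s := fun h => hnc h.isCompact
  simp only [IsSeqCompact, not_forall] at h
  obtain ⟨u, hu, hno⟩ := h
  refine ⟨u, hu, fun K hK => ?_⟩
  by_contra hinf
  obtain ⟨φ, hφ, hφK⟩ := extraction_of_frequently_atTop (Nat.frequently_atTop_iff_infinite.2 hinf)
  obtain ⟨a, -, ψ, hψ, ha⟩ := hK.tendsto_subseq hφK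
  exact hno ⟨a, hs.mem_of_tendsto ha (Eventually.of_forall fun n => hu _), φ ∘ ψ,
    hφ.comp hψ, ha⟩

/-- Each ball about a point with no compact neighbourhood contains a sequence that compact sets meet
finitely often, so each compact set is bounded by a function. With fewer than 𝔟 of them, a diagonal
sequence converges to the point yet meets each one finitely often. -/
theorem boundingNumber_le_kNumber (M : Type v) [MetricSpace M]
    [TopologicalSpace.SeparableSpace M] (hM : ¬ SigmaCompactSpace M) :
    Cardinal.lift.{v} boundingNumber ≤ kNumber M := by
  have : SecondCountableTopology M := UniformSpace.secondCountable_of_separable M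
  obtain ⟨C, hC, hgen, hcard⟩ := exists_isGenerating_mk_eq_kNumber M
  rw [← hcard]
  by_contra! hlt
  have hx : ∃ x : M, ∀ K, IsCompact K → K ∉ 𝓝 x := by
    by_contra! h
    have : WeaklyLocallyCompactSpace M := ⟨h⟩
    exact hM inferInstance
  obtain ⟨x, hx⟩ := hx
  have hu : ∀ n : ℕ, ∃ u : ℕ → M, (∀ m, u m ∈ Metric.closedBall x (1 / ((n : ℝ) + 1))) ∧
      ∀ K, IsCompact K → {m | u m ∈ K}.Finite := fun n =>
    exists_seq_finite_inter_compact Metric.isClosed_closedBall fun h =>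
      hx _ h (Metric.closedBall_mem_nhds x (Nat.one_div_pos_of_nat))
  choose u hu hfin using hu
  have hbd : ∀ K, IsCompact K → ∃ f : ℕ → ℕ, ∀ n m, u n m ∈ K → m ≤ f n := fun K hK => by
    have h : ∀ n, ∃ b, ∀ m ∈ {m | u n m ∈ K}, m ≤ b := fun n => (hfin n K hK).bddAbove
    choose f hf using h
    exact ⟨f, hf⟩
  obtain ⟨f₀, hf₀⟩ := hbd {x} isCompact_singleton
  choose f hf using fun K : C => hbd K (hC K K.2)
  obtain ⟨g, hg⟩ := exists_modFiniteLT_of_mk_lt f hlt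
  -- The summand `g n` eventually escapes every member of `C`; `f₀ n + 1` keeps the terms different
  -- from `x`.
  have hlim : Tendsto (fun n => u n (g n + f₀ n + 1)) atTop (𝓝 x) :=
    tendsto_iff_dist_tendsto_zero.2 (squeeze_zero (fun _ => dist_nonneg) (fun n => hu n _)
      tendsto_one_div_add_atTop_nhds_zero_nat)
  obtain ⟨K, hK, hinf⟩ := hgen.exists_infinite hlim fun n hn => by
    have := hf₀ n _ hn
    omega
  refine hinf ((hg ⟨K, hK⟩).subset fun n hn => ?_)
  have := hf ⟨K, hK⟩ n _ hn
  simp only [Set.mem_ofPred_eq]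
  omega

/-- Points near `x` code finite subsets of μ. A countable compact set decodes to a countable subset
of μ, the union of the finite sets it codes. -/
theorem covNumber_le_kNumber {M : Type v} [MetricSpace M] (hM : IsTotallyImperfect M)
    {μ : Cardinal.{v}} (hμ : ℵ₀ ≤ μ) {x : M} (hx : ∀ U ∈ 𝓝 x, μ ≤ #U) :
    covNumber μ ≤ kNumber M := by
  obtain ⟨C, hC, hgen, hcard⟩ := exists_isGenerating_mk_eq_kNumber M
  rw [← hcard]
  have hinf : Infinite μ.out := Cardinal.infinite_iff.2 (by simpa using hμ)
  have hφ : ∀ n : ℕ, Nonempty (Finset μ.out ↪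
      (Metric.ball x (1 / ((n : ℝ) + 1)) \ {x} : Set M)) := fun n => by
    rw [← Cardinal.le_def, Cardinal.mk_finset_of_infinite, Cardinal.mk_out]
    by_contra! hlt
    have h1 := hx _ (Metric.ball_mem_nhds x (Nat.one_div_pos_of_nat (n := n) (α := ℝ)))
    have h2 : #(Metric.ball x (1 / ((n : ℝ) + 1))) ≤
        #(Metric.ball x (1 / ((n : ℝ) + 1)) \ {x} : Set M) + #({x} : Set M) :=
      Cardinal.le_mk_sdiff_add_mk _ _
    refine absurd (h1.trans h2) (not_le.2 (Cardinal.add_lt_of_lt hμ hlt ?_))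
    simpa using Cardinal.one_lt_aleph0.trans_le hμ
  let φ := fun n => (hφ n).some
  rw [← Cardinal.mk_out μ]
  refine covNumber_le_of_family (α := μ.out) (ι := C)
    (fun K => ⋃ n, ⋃ s ∈ (fun s => (φ n s : M)) ⁻¹' (K : Set M), (s : Set μ.out)) ?_ ?_
  · refine fun K => Set.countable_iUnion fun n => Set.Countable.biUnion ?_
      fun s _ => s.countable_toSet
    exact (hM K (hC K K.2)).preimage (Subtype.val_injective.comp (φ n).injective)
  · intro B hB
    classical
    obtain ⟨b, hb⟩ := Set.countable_iff_exists_subset_range.1 hB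
    -- The terms code increasing initial parts of `b`, so infinitely many of them recover all its
    -- values.
    have hlim : Tendsto (fun n => (φ n ((Finset.range n).image b) : M)) atTop (𝓝 x) :=
      tendsto_iff_dist_tendsto_zero.2 (squeeze_zero (fun _ => dist_nonneg)
        (fun n => (φ n _).2.1.le) tendsto_one_div_add_atTop_nhds_zero_nat)
    obtain ⟨K, hK, hKinf⟩ := hgen.exists_infinite hlim fun n => (φ n _).2.2
    refine ⟨⟨K, hK⟩, fun c hc => ?_⟩
    obtain ⟨m, rfl⟩ := hb hc
    obtain ⟨n, hn, hmn⟩ := hKinf.exists_gt m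
    refine Set.mem_iUnion.2 ⟨n, Set.mem_biUnion (x := (Finset.range n).image b) hn ?_⟩
    exact Finset.mem_coe.2 (Finset.mem_image_of_mem b (Finset.mem_range.2 hmn))

/-! ### Cardinality -/

theorem aleph0_lt_mk_of_not_sigmaCompactSpace {M : Type v} [TopologicalSpace M]
    (hM : ¬ SigmaCompactSpace M) : ℵ₀ < #M := by
  by_contra! h
  have : Countable M := Cardinal.mk_le_aleph0_iff.1 h
  refine hM (isSigmaCompact_univ_iff.1 ?_)
  rw [← Set.biUnion_of_singleton Set.univ]
  exact isSigmaCompact_biUnion Set.countable_univ fun x _ => isCompact_singleton.isSigmaCompact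

theorem kcNumber_eq_mk {M : Type v} [TopologicalSpace M] (hM : IsTotallyImperfect M)
    (hcard : ℵ₀ < #M) : kcNumber M = #M := by
  refine le_antisymm ?_ (le_csInf ⟨_, Set.range fun x : M => {x}, ?_, ?_, rfl⟩ ?_)
  · refine le_trans (csInf_le' ⟨Set.range fun x : M => {x}, ?_, ?_, rfl⟩) Cardinal.mk_range_le
    · rintro _ ⟨x, rfl⟩
      exact isCompact_singleton
    · exact Set.eq_univ_of_forall fun x => ⟨{x}, ⟨x, rfl⟩, rfl⟩
  · rintro _ ⟨x, rfl⟩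
    exact isCompact_singleton
  · exact Set.eq_univ_of_forall fun x => ⟨{x}, ⟨x, rfl⟩, rfl⟩
  · rintro _ ⟨C, hC, hcov, rfl⟩
    have h1 : #M ≤ #C * ℵ₀ := by
      rw [← Cardinal.mk_univ, ← hcov]
      refine (Cardinal.mk_sUnion_le C).trans (mul_le_mul_right ?_ _)
      exact ciSup_le' fun K => (Cardinal.le_aleph0_iff_set_countable).2 (hM K (hC K K.2))
    have h2 := h1.trans (Cardinal.mul_le_max_of_aleph0_le_right le_rfl)
    exact (le_max_iff.1 h2).resolve_right (not_le.2 hcard)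

theorem exists_seq_nhds_cover {M : Type v} [TopologicalSpace M] [SecondCountableTopology M]
    [Nonempty M] {P : Set M → Prop} (h : ∀ x, ∃ U ∈ 𝓝 x, P U) :
    ∃ U : ℕ → Set M, (∀ n, P (U n)) ∧ ∀ x, ∃ n, U n ∈ 𝓝 x := by
  choose U hU hP using h
  obtain ⟨s, hs, hcov⟩ := TopologicalSpace.countable_cover_nhds
    (f := fun x => interior (U x)) fun x => interior_mem_nhds.2 (hU x)
  have hne : s.Nonempty := by
    by_contra! h
    simp [h] at hcov
    exact Set.empty_ne_univ hcov
  obtain ⟨e, rfl⟩ := hs.exists_eq_range hne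
  refine ⟨fun n => U (e n), fun n => hP _, fun x => ?_⟩
  obtain ⟨_, ⟨n, rfl⟩, hx⟩ := Set.mem_iUnion₂.1 (hcov.symm ▸ Set.mem_univ x)
  exact ⟨n, mem_interior_iff_mem_nhds.1 hx⟩

/-- Otherwise countably many sets of size below μ would cover `M`. -/
theorem exists_forall_nhds_le_mk {M : Type v} [TopologicalSpace M] [SecondCountableTopology M]
    {μ : Cardinal.{v}} (hμ : ℵ₀ ≤ μ) (h : μ < #M) : ∃ x : M, ∀ U ∈ 𝓝 x, μ ≤ #U := by
  by_contra! hn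
  have : Nonempty M := Cardinal.mk_ne_zero_iff.1 (pos_of_gt h).ne'
  obtain ⟨U, hU, hcov⟩ := exists_seq_nhds_cover hn
  refine absurd h (not_lt.2 ?_)
  have hun : ⋃ n, U n = Set.univ :=
    Set.eq_univ_of_forall fun x => (hcov x).elim fun n hn => Set.mem_iUnion.2 ⟨n, mem_of_mem_nhds hn⟩
  rw [← Cardinal.mk_univ, ← hun]
  have h1 := Cardinal.mk_iUnion_le_sum_mk_lift (f := U)
  have h2 : Cardinal.sum (fun n => #(U n)) ≤ μ :=
    (Cardinal.sum_le_sum _ (fun _ => μ) fun n => (hU n).le).trans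
      (by simp [Cardinal.aleph0_mul_eq hμ])
  simpa using h1.trans (by simpa using h2)

theorem IsLocallySmall.mk_lt_continuum {M : Type v} [TopologicalSpace M] [T0Space M]
    [SecondCountableTopology M] [Nonempty M] (hM : IsLocallySmall M) : #M < 𝔠 := by
  have hle : #M ≤ 𝔠 := by
    let B := TopologicalSpace.countableBasis M
    have hinj : Function.Injective fun x : M => {U : B | x ∈ (U : Set M)} := fun x y hxy => by
      refine ((TopologicalSpace.isBasis_countableBasis M).inseparable_iff.2 fun U hU => ?_).eq
      exact Set.ext_iff.1 hxy ⟨U, hU⟩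
    refine (Cardinal.mk_le_of_injective hinj).trans ?_
    rw [Cardinal.mk_set, ← Cardinal.two_power_aleph0]
    exact Cardinal.power_le_power_left two_ne_zero
      (Cardinal.le_aleph0_iff_set_countable.2 (TopologicalSpace.countable_countableBasis M))
  refine hle.lt_of_ne fun heq => ?_
  obtain ⟨U, hU, hcov⟩ := exists_seq_nhds_cover hM
  have hun : ⋃ n, U n = Set.univ :=
    Set.eq_univ_of_forall fun x => (hcov x).elim fun n hn => Set.mem_iUnion.2 ⟨n, mem_of_mem_nhds hn⟩
  have h1 := Cardinal.mk_iUnion_le_sum_mk_lift (f := U)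
  rw [hun, Cardinal.mk_univ] at h1
  -- König's theorem: 𝔠 is not a countable sum of smaller cardinals, as 𝔠 ^ ℵ₀ = 𝔠.
  have h2 := Cardinal.sum_lt_prod (fun n => #(U n)) (fun _ => 𝔠) fun n => heq ▸ hU n
  rw [Cardinal.prod_const] at h2
  simp [heq] at h1 h2
  exact absurd h2 (not_lt.2 h1)

/-- An uncountable compact metric space contains a copy of the Cantor set. -/
theorem isTotallyImperfect_of_mk_lt_continuum {M : Type v} [MetricSpace M] (h : #M < 𝔠) :
    IsTotallyImperfect M := by
  intro K hK
  by_contra hcount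
  have : CompactSpace K := isCompact_iff_compactSpace.1 hK
  obtain ⟨f, -, -, hf⟩ := isClosed_univ.exists_nat_bool_injection_of_not_countable (α := K)
    (C := Set.univ) fun h => hcount (by simpa [Set.countable_univ_iff] using h)
  have h1 := Cardinal.lift_mk_le_lift_mk_of_injective (Subtype.val_injective.comp hf)
  simp at h1
  exact absurd h (not_lt.2 h1)

theorem covNumber_mul_boundingNumber_le {μ k : Cardinal.{v}} (h1 : covNumber μ ≤ k)
    (h2 : Cardinal.lift.{v} boundingNumber ≤ k) :
    covNumber μ * Cardinal.lift.{v} boundingNumber ≤ k := by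
  have hb : ℵ₀ ≤ Cardinal.lift.{v} boundingNumber :=
    Cardinal.aleph0_le_lift.2 aleph0_le_boundingNumber
  exact (Cardinal.mul_le_max_of_aleph0_le_right hb).trans (max_le h1 h2)

theorem kNumber_eq_of_not_isLocallySmall (M : Type v) [MetricSpace M]
    [TopologicalSpace.SeparableSpace M] (hM : ¬ SigmaCompactSpace M)
    (hti : IsTotallyImperfect M) (hls : ¬ IsLocallySmall M) :
    kNumber M = covNumber (kcNumber M) * Cardinal.lift.{v} boundingNumber := by
  have hunc := aleph0_lt_mk_of_not_sigmaCompactSpace hM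
  rw [kcNumber_eq_mk hti hunc]
  simp only [IsLocallySmall, not_forall, not_exists, not_and, not_lt] at hls
  obtain ⟨x, hx⟩ := hls
  exact le_antisymm (kNumber_le_covNumber_mul M) (covNumber_mul_boundingNumber_le
    (covNumber_le_kNumber hti hunc.le hx) (boundingNumber_le_kNumber M hM))

theorem kNumber_eq_of_isLocallySmall (M : Type v) [MetricSpace M]
    [TopologicalSpace.SeparableSpace M] (hM : ¬ SigmaCompactSpace M) (hls : IsLocallySmall M) :
    kNumber M = limBelow (kcNumber M)
      (fun μ => covNumber μ * Cardinal.lift.{v} boundingNumber) := by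
  have : SecondCountableTopology M := UniformSpace.secondCountable_of_separable M
  have hunc := aleph0_lt_mk_of_not_sigmaCompactSpace hM
  have : Nonempty M := Cardinal.mk_ne_zero_iff.1 (pos_of_gt hunc).ne'
  have hti := isTotallyImperfect_of_mk_lt_continuum hls.mk_lt_continuum
  have hb : ℵ₀ ≤ Cardinal.lift.{v} boundingNumber :=
    Cardinal.aleph0_le_lift.2 aleph0_le_boundingNumber
  have hbk := boundingNumber_le_kNumber M hM
  rw [kcNumber_eq_mk hti hunc]
  have hlub := isLUB_limBelow #M (pos_of_gt hunc).ne'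
    (fun μ => covNumber μ * Cardinal.lift.{v} boundingNumber)
  refine le_antisymm ?_ (hlub.2 ?_)
  · obtain ⟨U, hU, hcov⟩ := exists_seq_nhds_cover hls
    choose C hC hcard hgen using fun n => exists_compact_family (U n)
    set L := limBelow #M (fun μ => covNumber μ * Cardinal.lift.{v} boundingNumber)
    have hle : ∀ n, #(C n) ≤ L := fun n => (hcard n).trans (hlub.1 ⟨_, hU n, rfl⟩)
    have hone : 1 ≤ covNumber #(U 0) := by
      obtain ⟨ι, F, -, hcof, hι⟩ := exists_family_mk_le_covNumber (U 0)
      obtain ⟨i, -⟩ := hcof ∅ Set.countable_empty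
      rw [← hι, Cardinal.one_le_iff_ne_zero, Cardinal.mk_ne_zero_iff]
      exact ⟨i⟩
    have hL : ℵ₀ ≤ L := hb.trans ((le_mul_of_one_le_left' hone).trans (hlub.1 ⟨_, hU 0, rfl⟩))
    refine le_trans (csInf_le' ⟨⋃ n, C n, ?_, isGenerating_of_mem_closure ?_, rfl⟩) ?_
    · intro K hK
      obtain ⟨n, hn⟩ := Set.mem_iUnion.1 hK
      exact hC n K hn
    · intro B x hx
      obtain ⟨n, hn⟩ := hcov x
      obtain ⟨K, hK, h⟩ := hgen n B x hn hx
      exact ⟨K, Set.mem_iUnion.2 ⟨n, hK⟩, h⟩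
    · have h1 := Cardinal.mk_iUnion_le_sum_mk_lift (f := C)
      have h2 : Cardinal.sum (fun n => #(C n)) ≤ L :=
        (Cardinal.sum_le_sum _ (fun _ => L) hle).trans (by simp [Cardinal.aleph0_mul_eq hL])
      simpa using h1.trans (by simpa using h2)
  · rintro _ ⟨μ, hμ, rfl⟩
    refine covNumber_mul_boundingNumber_le ?_ hbk
    -- The coding argument needs μ infinite; for countable μ the covering number is at most 1.
    rcases le_total μ ℵ₀ with h | h
    · exact (covNumber_le_one h).trans (Cardinal.one_le_aleph0.trans (hb.trans hbk))
    · obtain ⟨x, hx⟩ := exists_forall_nhds_le_mk h hμ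
      exact covNumber_le_kNumber hti h hx

theorem mainTheorem3 (M : Type u) [TopologicalSpace M] [TopologicalSpace.MetrizableSpace M]
    [TopologicalSpace.SeparableSpace M] (hM : ¬ SigmaCompactSpace M) :
    (IsTotallyImperfect M → ¬ IsLocallySmall M →
      kNumber M = covNumber (kcNumber M) * Cardinal.lift.{u} boundingNumber) ∧
    (IsLocallySmall M →
      kNumber M =
        limBelow (kcNumber M) (fun μ => covNumber μ * Cardinal.lift.{u} boundingNumber)) := by
  let _ := TopologicalSpace.metrizableSpaceMetric M
  exact ⟨kNumber_eq_of_not_isLocallySmall M hM, kNumber_eq_of_isLocallySmall M hM⟩
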